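/- For $0\le p\le 1$ let $G(n,p)$ be the random graph on $n$ nodes in which every two nodes are joined by an edge independently with probability $p$. A set $S$ of nodes of a graph $G=(V,E)$ is a hub for $T\subseteq V$ if the induced subgraph $G_S$ is connected (in particular $S\neq\emptyset$) and every $u\in T$ has a neighbour in $S$. Pairwise disjoint sets $N_1,\dots,N_r\subseteq V$ form an $r$-partition of $G$ if $\bigcup_i N_i=V$ and, for every $i$, $V\setminus N_i$ is a hub for $N_i$. All $k$-sparse vectors associated with $G$ can be identified with $m$ measurements if there is an $m\times |V|$ matrix $A$ with entries in $\{0,1\}$ such that for each row the nodes with entry $1$ induce a connected subgraph of $G$, and $Ax\neq Ay$ for any two different vectors $x,y\in\mathbb R^V$ with at most $k$ non-zero entries each. (1) Let $\beta>1$ and $\epsilon\in(0,\beta-1)$ be constants. There are $\alpha>0$ and $C>0$ (depending only on $\beta,\epsilon$) such that for all sufficiently large $n$, with $p=\beta\log n/n$: (a) for every (fixed) set $S$ of $n/(\beta-\epsilon)$ nodes, rounded down or up to an integer, $S$ is a hub for $V\setminus S$ in $G(n,p)$ with probability at least $1-Cn^{-\alpha}$; (b) with probability at least $1-Cn^{-\alpha}$,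 $G(n,p)$ has a $\left\lceil\frac{\beta-\epsilon}{\beta-\epsilon-1}\right\rceil$-partition. (2) There is an absolute constant $K>0$ such that for every constant $\beta>1$ there are $\alpha>0$ and $C>0$ (depending only on $\beta$) such that for all sufficiently large $n$, with $p=\beta\log n/n$, with probability at least $1-Cn^{-\alpha}$ the following holds: for every integer $k$ with $1\le k\le n/2$, all $k$-sparse vectors associated with $G(n,p)$ can be identified with at most $K\left\lceil\frac{\beta}{\beta-1}\right\rceil k\log(n/k)$ measurements. -/

import Mathlib

open Filter

/-- `S` is a hub for `T` in `G`: the subgraph induced by `S` is connected, and every node of `T`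
has a neighbour in `S`. -/
def IsHub {V : Type*} (G : SimpleGraph V) (S T : Set V) : Prop :=
  (G.induce S).Connected ∧ ∀ u ∈ T, ∃ s ∈ S, G.Adj u s

/-- The sets `N i`, `i : Fin r`, form an `r`-partition of `G`: they are disjoint, they cover all
nodes, and the complement of each of them is a hub for it. -/
def IsRPartition {V : Type*} (G : SimpleGraph V) (r : ℕ) (N : Fin r → Set V) : Prop :=
  (∀ i j, i ≠ j → Disjoint (N i) (N j)) ∧ (⋃ i, N i) = Set.univ ∧
    ∀ i, IsHub G (N i)ᶜ (N i)

/-- `G` has an `r`-partition. -/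
def HasRPartition {V : Type*} (G : SimpleGraph V) (r : ℕ) : Prop :=
  ∃ N : Fin r → Set V, IsRPartition G r N

/-- `A` is a feasible measurement matrix for `G`: it has entries in `{0, 1}`, and for each row the
nodes with entry `1` induce a connected subgraph of `G`. -/
def IsMeasurementMatrix {V ι : Type*} (G : SimpleGraph V) (A : Matrix ι V ℝ) : Prop :=
  (∀ i v, A i v = 0 ∨ A i v = 1) ∧ ∀ i, (G.induce {v | A i v = 1}).Connected

/-- `A` identifies all `k`-sparse vectors: different vectors with at most `k` non-zero entries
each have different images under `A`. -/
def IdentifiesSparse {V ι : Type*} [Fintype V] (A : Matrix ι V ℝ) (k : ℕ) : Prop :=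
  ∀ x y : V → ℝ, {v | x v ≠ 0}.ncard ≤ k → {v | y v ≠ 0}.ncard ≤ k → x ≠ y →
    A.mulVec x ≠ A.mulVec y

/-- All `k`-sparse vectors associated with `G` can be identified with `m` measurements. -/
def IdentifiableWith {V : Type*} [Fintype V] (G : SimpleGraph V) (k m : ℕ) : Prop :=
  ∃ A : Matrix (Fin m) V ℝ, IsMeasurementMatrix G A ∧ IdentifiesSparse A k

/-!
The proof bounds the probability that a set `S` of `s ≥ n / γ - 1` nodes, `1 < γ < β`, fails to be a
hub for its complement. If it fails, then some outside node has no neighbour in `S`, or `S` splits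
into two parts without edges between them, the smaller being `A` with `|A| ≤ s / 2`. Since `p s` is at
least `θ' log n` for a constant `θ' > 1`, the first event has probability at most
`n * n ^ (-θ')`, and the second is controlled by a sum over all cuts: a small `A` of size `a` costs
about `n ^ (-(1 + α) a)`, which beats the `n ^ a` choices, and a linear-sized `A` costs
`exp (-c s log n)`, which beats the `2 ^ s` choices (`sum_cut_le`, `exists_not_isHub_bound`).

For the partition, the nodes are split into `r = ⌈γ / (γ - 1)⌉` blocks of at most `n / r + 1` nodes.
The complement of each block has at least `n / γ - 1` nodes, so a union bound over the fixed number of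
blocks gives an `r`-partition (`exists_not_hasRPartition_bound`).

An `r`-partition makes unrestricted `0/1` measurements of each part available at the price of one
extra measurement of its hub (`identifiableWith_of_isRPartition`), for every `k` at once. A `0/1`
matrix with `O(k log (n / k))` rows and no nonzero `2k`-sparse kernel vector exists by the
Gilbert–Varshamov argument over the field with two elements, and independence of columns modulo 2
implies independence over `ℝ` (`exists_binary_matrix_sparse_kernel`).
-/

/-! ### Hubs, cuts and partitions in a fixed graph -/

/-- A nonempty set that induces a disconnected graph can be cut without crossing edges; the smaller
side of the cut has at most half of the nodes. -/
theorem exists_isolated_of_not_connected {V : Type*} [DecidableEq V] (G : SimpleGraph V)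
    (S : Finset V) (hS : S.Nonempty) (h : ¬ (G.induce (S : Set V)).Connected) :
    ∃ A ⊆ S, A.Nonempty ∧ 2 * A.card ≤ S.card ∧ ∀ a ∈ A, ∀ b ∈ S \ A, ¬ G.Adj a b := by
  classical
  obtain ⟨v, hv⟩ := hS
  have : ∃ w, ¬ (G.induce (S : Set V)).Reachable ⟨v, hv⟩ w := by
    by_contra! hc
    exact h ((SimpleGraph.connected_iff_exists_forall_reachable _).2 ⟨_, hc⟩)
  obtain ⟨⟨w, hwS⟩, hw⟩ := this
  set B : Finset V := S.filter fun x => ∃ hx : x ∈ (S : Set V),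
    (G.induce (S : Set V)).Reachable ⟨v, hv⟩ ⟨x, hx⟩ with hB
  have hBS : B ⊆ S := Finset.filter_subset _ _
  have hvB : v ∈ B := Finset.mem_filter.2 ⟨hv, hv, SimpleGraph.Reachable.refl _⟩
  have hwB : w ∈ S \ B := by
    refine Finset.mem_sdiff.2 ⟨hwS, fun hc => ?_⟩
    obtain ⟨_, _, h2⟩ := Finset.mem_filter.1 hc
    exact hw h2
  have hsep : ∀ a ∈ B, ∀ b ∈ S \ B, ¬ G.Adj a b := by
    intro a ha b hb hab
    obtain ⟨_, haS, har⟩ := Finset.mem_filter.1 ha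
    obtain ⟨hbS, hbB⟩ := Finset.mem_sdiff.1 hb
    refine hbB (Finset.mem_filter.2 ⟨hbS, hbS, har.trans (SimpleGraph.Adj.reachable ?_)⟩)
    simpa using hab
  have hcard := Finset.card_sdiff_add_card_eq_card hBS
  by_cases hle : 2 * B.card ≤ S.card
  · exact ⟨B, hBS, ⟨v, hvB⟩, hle, hsep⟩
  · refine ⟨S \ B, Finset.sdiff_subset, ⟨w, hwB⟩, by omega, fun a ha b hb hab => ?_⟩
    rw [Finset.sdiff_sdiff_eq_self hBS] at hb
    exact hsep b hb a ha hab.symm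

theorem IsHub.connected_induce_union {V : Type*} {G : SimpleGraph V} {S T W : Set V}
    (h : IsHub G S T) (hW : W ⊆ T) : (G.induce (S ∪ W)).Connected := by
  obtain ⟨hc, hn⟩ := h
  obtain ⟨u, hu⟩ := (SimpleGraph.connected_iff_exists_forall_reachable _).1 hc
  have hSr : ∀ s (hs : s ∈ S), (G.induce (S ∪ W)).Reachable ⟨u, Or.inl u.2⟩ ⟨s, Or.inl hs⟩ :=
    fun s hs => (hu ⟨s, hs⟩).map
      (SimpleGraph.induceHomOfLE G (Set.subset_union_left : S ⊆ S ∪ W)).toHom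
  refine (SimpleGraph.connected_iff_exists_forall_reachable _).2 ⟨⟨u, Or.inl u.2⟩, ?_⟩
  rintro ⟨v, hv | hv⟩
  · exact hSr v hv
  · obtain ⟨s, hs, hvs⟩ := hn v (hW hv)
    refine (hSr s hs).trans (SimpleGraph.Adj.reachable ?_)
    simpa using hvs.symm

/-- Given an `r`-partition with parts `N i`, a `0/1` matrix `M` whose kernel contains no nonzero
`2k`-sparse vector yields feasible measurements: for each `i`, the indicator of the hub `(N i)ᶜ`, and
for each row of `M` the indicator of the hub together with the part of that row inside `N i`.
Subtracting the hub measurement recovers `M` applied to the restriction of the vector to `N i`. -/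
theorem identifiableWith_of_isRPartition {V : Type*} [Fintype V] {G : SimpleGraph V} {r k m : ℕ}
    {N : Fin r → Set V} (hN : IsRPartition G r N) (M : Matrix (Fin m) V ℝ)
    (hM : ∀ i v, M i v = 0 ∨ M i v = 1)
    (hker : ∀ z : V → ℝ, {v | z v ≠ 0}.ncard ≤ 2 * k → M.mulVec z = 0 → z = 0) :
    IdentifiableWith G k (r * (m + 1)) := by
  classical
  obtain ⟨-, hcov, hhub⟩ := hN
  -- The index `none` stands for the hub alone, `some a` for the hub and the part of row `a`.
  let W : Fin r × Option (Fin m) → Set V := fun q =>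
    (N q.1)ᶜ ∪ {v | v ∈ N q.1 ∧ ∃ a, q.2 = some a ∧ M a v = 1}
  let A : Matrix (Fin r × Option (Fin m)) V ℝ := fun q v => if v ∈ W q then 1 else 0
  have hA1 : ∀ q, {v | A q v = 1} = W q := fun q => by ext v; simp [A]
  let e : Fin (r * (m + 1)) ≃ Fin r × Option (Fin m) :=
    finProdFinEquiv.symm.trans (Equiv.prodCongr (Equiv.refl _) (finSuccEquiv m))
  refine ⟨A.submatrix e id, ⟨fun i v => ?_, fun i => ?_⟩, fun x y hx hy hxy heq => hxy ?_⟩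
  · by_cases h : v ∈ W (e i)
    · right; exact if_pos h
    · left; exact if_neg h
  · change (G.induce {v | A (e i) v = 1}).Connected
    rw [hA1]
    exact (hhub _).connected_induce_union fun v hv => hv.1
  · have hq : ∀ q, ∑ v, A q v * (x v - y v) = 0 := by
      intro q
      have := congrFun heq (e.symm q)
      simp only [Matrix.mulVec, dotProduct, Matrix.submatrix_apply, id, Equiv.apply_symm_apply] at this
      simp only [mul_sub, Finset.sum_sub_distrib, this, sub_self]
    -- The restriction of `x - y` to each part lies in the kernel of `M`.
    have hrestr : ∀ i : Fin r, (fun v => if v ∈ N i then x v - y v else 0) = 0 := by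
      intro i
      apply hker
      · calc _ ≤ ({v | x v ≠ 0} ∪ {v | y v ≠ 0}).ncard := by
              apply Set.ncard_le_ncard _ (Set.toFinite _)
              intro v hv
              by_contra hc
              simp only [Set.mem_union, Set.mem_ofPred_eq, not_or, not_not] at hc
              simp [hc.1, hc.2] at hv
          _ ≤ _ := Set.ncard_union_le _ _
          _ ≤ 2 * k := by omega
      · ext a
        have h1 := hq (i, some a)
        have h0 := hq (i, none)
        refine Eq.trans ?_ (sub_eq_zero.2 (h1.trans h0.symm))
        rw [← Finset.sum_sub_distrib]
        refine Finset.sum_congr rfl fun v _ => ?_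
        by_cases hv : v ∈ N i
        · rcases hM a v with h | h <;> simp [A, W, hv, h]
        · simp [A, W, hv]
    ext v
    obtain ⟨i, hi⟩ := Set.mem_iUnion.1 (hcov ▸ Set.mem_univ v : v ∈ ⋃ i, N i)
    have := congrFun (hrestr i) v
    simpa [hi, sub_eq_zero] using this

/-! ### Binary matrices with no sparse kernel vector -/

/-- A nonzero vector over the field with two elements is orthogonal to at most half of all vectors:
adding a suitable unit vector flips the value of the product. -/
theorem two_mul_card_dotProduct_eq_zero_le {V : Type*} [Fintype V] [DecidableEq V]
    {z : V → ZMod 2} (hz : z ≠ 0) :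
    2 * (Finset.univ.filter fun r : V → ZMod 2 => r ⬝ᵥ z = 0).card ≤
      Fintype.card (V → ZMod 2) := by
  obtain ⟨v, hv⟩ := Function.ne_iff.1 hz
  have hle : (Finset.univ.filter fun r : V → ZMod 2 => r ⬝ᵥ z = 0).card ≤
      (Finset.univ.filter fun r : V → ZMod 2 => ¬ r ⬝ᵥ z = 0).card := by
    refine Finset.card_le_card_of_injOn (fun r => r + Pi.single v 1) (fun r hr => ?_)
      fun a _ b _ hab => add_right_cancel hab
    have hr' : r ⬝ᵥ z = 0 := by simpa using hr
    simpa [add_dotProduct, hr'] using hv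
  have := Finset.card_filter_add_card_filter_not (s := (Finset.univ : Finset (V → ZMod 2)))
    (fun r => r ⬝ᵥ z = 0)
  rw [Finset.card_univ] at this
  omega

/-- By averaging, some row annihilates at most half of a given family of nonzero vectors. -/
theorem exists_two_mul_card_dotProduct_eq_zero_le {V : Type*} [Fintype V] [DecidableEq V]
    (Z : Finset (V → ZMod 2)) (hZ : ∀ z ∈ Z, z ≠ 0) :
    ∃ r : V → ZMod 2, 2 * (Z.filter fun z => r ⬝ᵥ z = 0).card ≤ Z.card := by
  by_contra! hc
  have h1 : ∑ _r : V → ZMod 2, Z.card <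
      ∑ r : V → ZMod 2, 2 * (Z.filter fun z => r ⬝ᵥ z = 0).card :=
    Finset.sum_lt_sum_of_nonempty Finset.univ_nonempty fun r _ => hc r
  have h2 : ∑ r : V → ZMod 2, (Z.filter fun z => r ⬝ᵥ z = 0).card =
      ∑ z ∈ Z, (Finset.univ.filter fun r : V → ZMod 2 => r ⬝ᵥ z = 0).card := by
    simp only [Finset.card_filter]
    exact Finset.sum_comm
  have h3 : ∑ z ∈ Z, 2 * (Finset.univ.filter fun r : V → ZMod 2 => r ⬝ᵥ z = 0).card ≤
      ∑ _z ∈ Z, Fintype.card (V → ZMod 2) :=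
    Finset.sum_le_sum fun z hz => two_mul_card_dotProduct_eq_zero_le (hZ z hz)
  rw [← Finset.mul_sum, h2, Finset.mul_sum] at h1
  simp only [Finset.sum_const, smul_eq_mul, Finset.card_univ] at h1 h3
  linarith [mul_comm Z.card (Fintype.card (V → ZMod 2))]

/-- Fewer than `2 ^ m` nonzero vectors can be kept out of the kernel of a suitable matrix with `m`
rows: each row can be chosen to halve the vectors not yet detected. -/
theorem exists_matrix_forall_mulVec_ne_zero {V : Type*} [Fintype V] [DecidableEq V] (m : ℕ) :
    ∀ Z : Finset (V → ZMod 2), (∀ z ∈ Z, z ≠ 0) → Z.card < 2 ^ m →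
      ∃ M : Matrix (Fin m) V (ZMod 2), ∀ z ∈ Z, M.mulVec z ≠ 0 := by
  induction m with
  | zero =>
    intro Z _ hc
    have : Z = ∅ := by simpa using hc
    exact ⟨0, by simp [this]⟩
  | succ m ih =>
    intro Z hZ hc
    obtain ⟨r, hr⟩ := exists_two_mul_card_dotProduct_eq_zero_le Z hZ
    obtain ⟨M, hM⟩ := ih (Z.filter fun z => r ⬝ᵥ z = 0)
      (fun z hz => hZ z (Finset.mem_filter.1 hz).1) (by rw [pow_succ] at hc; omega)
    refine ⟨Matrix.of (Fin.cons r M), fun z hz h0 => ?_⟩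
    have hrz : r ⬝ᵥ z = 0 := congrFun h0 0
    refine hM z (Finset.mem_filter.2 ⟨hz, hrz⟩) ?_
    ext i
    exact congrFun h0 i.succ

theorem Fintype.sum_subtype_eq_sum {V R : Type*} [Fintype V] [AddCommMonoid R] (p : V → Prop)
    [DecidablePred p] (f : V → R) (hf : ∀ v, ¬ p v → f v = 0) :
    ∑ v : {v // p v}, f v = ∑ v, f v := by
  rw [← Finset.sum_subtype (Finset.univ.filter p) (by simp), Finset.sum_filter]
  exact Finset.sum_congr rfl fun v _ => ite_eq_left_iff.2 fun h => (hf v h).symm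

/-- If a matrix over the field with two elements has no nonzero `t`-sparse kernel vector, then neither
has its `0/1` lift to the reals. On a support of at most `t` columns the matrix has a left inverse
modulo 2; the product of the integer lifts has odd determinant, so it is invertible over `ℝ`. -/
theorem real_kernel_sparse_eq_zero {V : Type*} [Fintype V] {m t : ℕ}
    (M : Matrix (Fin m) V (ZMod 2))
    (hM : ∀ z : V → ZMod 2, {v | z v ≠ 0}.ncard ≤ t → M.mulVec z = 0 → z = 0)
    (z : V → ℝ) (hz : {v | z v ≠ 0}.ncard ≤ t)
    (h0 : (M.map fun a => (a.val : ℝ)).mulVec z = 0) : z = 0 := by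
  classical
  let T := {v // z v ≠ 0}
  let MT : Matrix (Fin m) T (ZMod 2) := M.submatrix id (↑)
  have hinj : LinearMap.ker (Matrix.toLin' MT) = ⊥ := by
    refine LinearMap.ker_eq_bot'.2 fun w hw => ?_
    let w' : V → ZMod 2 := fun v => if h : z v ≠ 0 then w ⟨v, h⟩ else 0
    have hw' : w' = 0 := by
      apply hM
      · refine (Set.ncard_le_ncard (fun v hv => ?_) (Set.toFinite _)).trans hz
        by_contra hc
        exact hv (dif_neg hc)
      · ext i
        have := congrFun hw i
        rw [Matrix.toLin'_apply] at this
        refine Eq.trans ?_ this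
        refine (Fintype.sum_subtype_eq_sum (fun v => z v ≠ 0) (fun v => M i v * w' v)
          fun v hv => ?_).symm.trans ?_
        · simp [w', hv]
        · exact Finset.sum_congr rfl fun v _ => by simp [w', MT, v.2]
    ext ⟨v, hv⟩
    have := congrFun hw' v
    simpa [w', hv] using this
  obtain ⟨g, hg⟩ := LinearMap.exists_leftInverse_of_injective _ hinj
  let B := LinearMap.toMatrix' g
  have hB : B * MT = 1 := by
    have := congrArg LinearMap.toMatrix' hg
    rwa [LinearMap.toMatrix'_comp, LinearMap.toMatrix'_toLin', LinearMap.toMatrix'_id] at this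
  let lift : ZMod 2 → ℤ := fun a => (a.val : ℤ)
  have hlift : ∀ a, Int.castRingHom (ZMod 2) (lift a) = a := fun a => by simp [lift]
  let D : Matrix T T ℤ := B.map lift * MT.map lift
  have hD2 : D.map (Int.castRingHom (ZMod 2)) = 1 := by
    rw [Matrix.map_mul, Matrix.map_map, Matrix.map_map, ← hB]
    congr 1 <;> ext i j <;> exact hlift _
  have hdet : D.det ≠ 0 := by
    intro h
    have := RingHom.map_det (Int.castRingHom (ZMod 2)) D
    rw [RingHom.mapMatrix_apply, hD2, h] at this
    simp at this
  have hdetR : (D.map (Int.castRingHom ℝ)).det ≠ 0 := by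
    have := RingHom.map_det (Int.castRingHom ℝ) D
    rw [RingHom.mapMatrix_apply] at this
    rw [← this]
    simpa using hdet
  have hzT : (fun v : T => z v) = 0 := by
    apply Matrix.eq_zero_of_mulVec_eq_zero hdetR
    rw [Matrix.map_mul, ← Matrix.mulVec_mulVec]
    suffices h : ((MT.map lift).map (Int.castRingHom ℝ)).mulVec (fun v : T => z v) = 0 by
      rw [h, Matrix.mulVec_zero]
    ext i
    refine Eq.trans ?_ (congrFun h0 i)
    refine Eq.trans ?_ (Fintype.sum_subtype_eq_sum (fun v => z v ≠ 0)
      (fun v => ((M i v).val : ℝ) * z v) fun v hv => ?_)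
    · exact Finset.sum_congr rfl fun v _ => by simp [lift, MT]
    · simp [not_not.1 hv]
  ext v
  by_contra hv
  exact hv (congrFun hzT ⟨v, hv⟩)

theorem sum_powerset_pow_card {V R : Type*} [CommSemiring R] (S : Finset V) (y : R) :
    ∑ A ∈ S.powerset, y ^ A.card = (1 + y) ^ S.card := by
  simpa using (Finset.prod_one_add (f := fun _ : V => y) S).symm

/-- The classical bound `∑_{j ≤ t} C(n, j) ≤ (e n / t) ^ t`, obtained by weighting each set `A` with
`(t / n) ^ |A|`. -/
theorem card_filter_card_le_le_exp {V : Type*} [Fintype V] {t : ℕ} (ht : 0 < t)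
    (htn : t ≤ Fintype.card V) :
    (((Finset.univ : Finset V).powerset.filter fun A => A.card ≤ t).card : ℝ) ≤
      Real.exp (t * (1 + Real.log (Fintype.card V / t))) := by
  set n := Fintype.card V
  have ht' : (0 : ℝ) < t := by exact_mod_cast ht
  have hn' : (0 : ℝ) < n := by exact_mod_cast ht.trans_le htn
  have hx0 : 0 < (t : ℝ) / n := by positivity
  have hx1 : (t : ℝ) / n ≤ 1 := (div_le_one hn').2 (by exact_mod_cast htn)
  have h1 : (((Finset.univ : Finset V).powerset.filter fun A => A.card ≤ t).card : ℝ) *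
      ((t : ℝ) / n) ^ t ≤ Real.exp t := by
    calc _ = ∑ A ∈ (Finset.univ : Finset V).powerset.filter (fun A => A.card ≤ t),
            ((t : ℝ) / n) ^ t := by rw [Finset.sum_const, nsmul_eq_mul]
      _ ≤ ∑ A ∈ (Finset.univ : Finset V).powerset.filter (fun A => A.card ≤ t),
            ((t : ℝ) / n) ^ A.card :=
          Finset.sum_le_sum fun A hA =>
            pow_le_pow_of_le_one hx0.le hx1 (Finset.mem_filter.1 hA).2
      _ ≤ ∑ A ∈ (Finset.univ : Finset V).powerset, ((t : ℝ) / n) ^ A.card :=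
          Finset.sum_le_sum_of_subset_of_nonneg (Finset.filter_subset _ _)
            fun A _ _ => by positivity
      _ = (1 + (t : ℝ) / n) ^ n := by rw [sum_powerset_pow_card, Finset.card_univ]
      _ ≤ Real.exp ((t : ℝ) / n) ^ n := by
          gcongr
          rw [add_comm]
          exact Real.add_one_le_exp _
      _ = Real.exp t := by
          rw [← Real.exp_nat_mul]
          congr 1
          field_simp
  have h2 : ((t : ℝ) / n) ^ t * Real.exp (t * Real.log (n / t)) = 1 := by
    rw [Real.exp_nat_mul, Real.exp_log (by positivity), ← mul_pow]
    rw [show (t : ℝ) / n * (n / t) = 1 by field_simp, one_pow]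
  calc _ = _ * (((t : ℝ) / n) ^ t * Real.exp (t * Real.log (n / t))) := by rw [h2, mul_one]
    _ ≤ Real.exp t * Real.exp (t * Real.log (n / t)) := by
        rw [← mul_assoc]
        gcongr
    _ = _ := by rw [← Real.exp_add]; ring_nf

/-- The Gilbert–Varshamov bound, transferred to real vectors. -/
theorem exists_binary_matrix_sparse_kernel {V : Type*} [Fintype V] {t m : ℕ} (ht : 0 < t)
    (htn : t ≤ Fintype.card V)
    (hm : Real.exp (t * (1 + Real.log (Fintype.card V / t))) < 2 ^ m) :
    ∃ M : Matrix (Fin m) V ℝ, (∀ i v, M i v = 0 ∨ M i v = 1) ∧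
      ∀ z : V → ℝ, {v | z v ≠ 0}.ncard ≤ t → M.mulVec z = 0 → z = 0 := by
  classical
  let Z : Finset (V → ZMod 2) := Finset.univ.filter fun z => z ≠ 0 ∧ {v | z v ≠ 0}.ncard ≤ t
  have hZ : Z.card < 2 ^ m := by
    have h1 : Z.card ≤ ((Finset.univ : Finset V).powerset.filter fun A => A.card ≤ t).card := by
      refine Finset.card_le_card_of_injOn (fun z => Finset.univ.filter fun v => z v ≠ 0)
        (fun z hz => ?_) fun a _ b _ hab => ?_
      · have := (Finset.mem_filter.1 hz).2.2
        rw [Set.ncard_eq_toFinset_card'] at this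
        simpa using this
      · ext v
        have := Finset.ext_iff.1 hab v
        simp only [Finset.mem_filter, Finset.mem_univ, true_and] at this
        generalize a v = x at this ⊢
        generalize b v = y at this ⊢
        revert x y
        decide
    exact_mod_cast ((Nat.cast_le.2 h1).trans (card_filter_card_le_le_exp ht htn)).trans_lt hm
  obtain ⟨M, hM⟩ := exists_matrix_forall_mulVec_ne_zero m Z
    (fun z hz => (Finset.mem_filter.1 hz).2.1) hZ
  refine ⟨M.map fun a => (a.val : ℝ), fun i v => ?_,
    real_kernel_sparse_eq_zero M fun z hz h0 => ?_⟩
  · have : ∀ a : ZMod 2, a.val = 0 ∨ a.val = 1 := by decide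
    rw [Matrix.map_apply]
    rcases this (M i v) with h | h <;> rw [h] <;> simp
  · by_contra hne
    exact hM z (Finset.mem_filter.2 ⟨Finset.mem_univ _, hne, hz⟩) h0

/-! ### The number of measurements for a partitioned graph -/

theorem identifiableWith_of_hasRPartition {n r k : ℕ} {G : SimpleGraph (Fin n)}
    (hG : HasRPartition G r) (hk : 1 ≤ k) (hkn : 2 * k ≤ n) :
    ∃ m : ℕ, (m : ℝ) ≤ 18 * r * k * Real.log ((n : ℝ) / k) ∧ IdentifiableWith G k m := by
  obtain ⟨N, hN⟩ := hG
  have hk' : (1 : ℝ) ≤ k := by exact_mod_cast hk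
  have hkn' : (2 : ℝ) * k ≤ n := by exact_mod_cast hkn
  set l := Real.log ((n : ℝ) / k) with hl
  have hl2 : Real.log 2 ≤ l :=
    Real.log_le_log (by norm_num) (by rw [le_div_iff₀ (by linarith)]; exact hkn')
  have hlog : (1 : ℝ) / 2 ≤ Real.log 2 := by linarith [Real.log_two_gt_d9]
  -- Since `n ≥ 2k`, the logarithm is bounded below, which absorbs all additive constants.
  have hl' : (1 : ℝ) / 2 ≤ l := hlog.trans hl2
  have hlt : Real.log ((n : ℝ) / (2 * k : ℕ)) ≤ l :=
    Real.log_le_log (by push_cast; apply div_pos <;> linarith)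
      (by push_cast; gcongr; linarith)
  set X : ℝ := 2 * k * (1 + l) / Real.log 2 with hX
  have hX0 : 0 ≤ X := by positivity
  obtain ⟨M, hM, hker⟩ := exists_binary_matrix_sparse_kernel (V := Fin n) (t := 2 * k)
    (m := ⌊X⌋₊ + 1) (by omega) (by simpa using hkn) (by
      rw [Fintype.card_fin, ← Real.exp_log (show (0 : ℝ) < 2 ^ (⌊X⌋₊ + 1) by positivity),
        Real.exp_lt_exp, Real.log_pow]
      have h1 : X < ((⌊X⌋₊ + 1 : ℕ) : ℝ) := by push_cast; exact Nat.lt_floor_add_one X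
      have h2 : 2 * k * (1 + l) < ((⌊X⌋₊ + 1 : ℕ) : ℝ) * Real.log 2 :=
        (div_lt_iff₀ (by linarith)).1 h1
      refine lt_of_le_of_lt ?_ h2
      push_cast at hlt ⊢
      gcongr)
  refine ⟨r * (⌊X⌋₊ + 1 + 1), ?_, identifiableWith_of_isRPartition hN M hM hker⟩
  have hXl : X ≤ 12 * (k * l) := by
    rw [hX, div_le_iff₀ (by linarith)]
    nlinarith [mul_nonneg (show (0 : ℝ) ≤ k by linarith) (show (0 : ℝ) ≤ l by linarith)]
  have hkl : (1 : ℝ) ≤ 2 * (k * l) := by nlinarith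
  have hfl := Nat.floor_le hX0
  push_cast
  rw [show (18 : ℝ) * r * k * l = r * (18 * (k * l)) by ring]
  gcongr
  linarith

/-! ### The probability that a set is not a hub -/

/-- The probability that a finite set of potential edges is avoided. -/
theorem binomialRandom_real_disjoint_edges_le {V : Type*} [Countable V] (p : unitInterval)
    (E : Finset (Sym2 V)) (hE : ∀ e ∈ E, ¬ e.IsDiag) :
    (SimpleGraph.binomialRandom V p).real {G | ∀ e ∈ E, e ∉ G.edgeSet} ≤
      (1 - (p : ℝ)) ^ E.card := by
  have h1 : SimpleGraph.binomialRandom V p {G | ∀ e ∈ E, e ∉ G.edgeSet} ≤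
      (unitInterval.toNNReal (unitInterval.symm p) : ENNReal) ^ E.card := by
    rw [SimpleGraph.binomialRandom_apply]
    refine (MeasureTheory.measure_mono (t := Set.pi E fun _ => {False}) ?_).trans ?_
    · rintro _ ⟨G, hG, rfl⟩ e he
      simpa using hG e he
    · rw [MeasureTheory.Measure.infinitePi_pi]
      · rw [← Finset.prod_const]
        refine Finset.prod_le_prod' fun e he => ?_
        simp [hE e he]
      · intro e _
        exact MeasurableSet.of_discrete
  rw [MeasureTheory.measureReal_def]
  refine (ENNReal.toReal_mono (by simp) h1).trans ?_
  simp

theorem binomialRandom_real_no_edges_between_le {V : Type*} [Countable V]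
    (p : unitInterval) {A B : Finset V} (hAB : Disjoint A B) :
    (SimpleGraph.binomialRandom V p).real {G | ∀ a ∈ A, ∀ b ∈ B, ¬ G.Adj a b} ≤
      (1 - (p : ℝ)) ^ (A.card * B.card) := by
  classical
  have hne : ∀ a ∈ A, ∀ b ∈ B, a ≠ b := fun a ha b hb h =>
    Finset.disjoint_left.1 hAB ha (h ▸ hb)
  let E : Finset (Sym2 V) := (A ×ˢ B).image fun x => s(x.1, x.2)
  have hEc : E.card = A.card * B.card := by
    rw [← Finset.card_product]
    refine Finset.card_image_of_injOn ?_
    rintro ⟨a, b⟩ hab ⟨c, d⟩ hcd h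
    simp only [Finset.coe_product, Set.mem_prod, Finset.mem_coe] at hab hcd
    rcases Sym2.eq_iff.1 h with ⟨h1, h2⟩ | ⟨h1, h2⟩
    · exact Prod.ext h1 h2
    · exact absurd h1 (hne _ hab.1 _ hcd.2)
  rw [← hEc]
  refine le_trans (MeasureTheory.measureReal_mono ?_)
    (binomialRandom_real_disjoint_edges_le p E fun e he => ?_)
  · intro G hG e he
    obtain ⟨⟨a, b⟩, hx, rfl⟩ := Finset.mem_image.1 he
    rw [Finset.mem_product] at hx
    simpa using hG a hx.1 b hx.2
  · obtain ⟨⟨a, b⟩, hx, rfl⟩ := Finset.mem_image.1 he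
    rw [Finset.mem_product] at hx
    simpa using hne a hx.1 b hx.2

/-- Union bound for the failure of `S` to be a hub for its complement: either a node outside `S` has
no neighbour in `S`, or `S` splits into `A` and `S \ A` without edges between them. -/
theorem binomialRandom_real_not_isHub_le {n : ℕ} (p : unitInterval) (S : Finset (Fin n))
    (hS : S.Nonempty) :
    (SimpleGraph.binomialRandom (Fin n) p).real {G | ¬ IsHub G (S : Set (Fin n)) (S : Set (Fin n))ᶜ} ≤
      n * (1 - (p : ℝ)) ^ S.card +
        ∑ A ∈ S.powerset.filter (fun A => A.Nonempty ∧ 2 * A.card ≤ S.card),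
          (1 - (p : ℝ)) ^ (A.card * (S.card - A.card)) := by
  classical
  set μ := SimpleGraph.binomialRandom (Fin n) p
  have hp1 : 0 ≤ 1 - (p : ℝ) := by linarith [p.2.2]
  set F := S.powerset.filter (fun A => A.Nonempty ∧ 2 * A.card ≤ S.card)
  have hsub : {G | ¬ IsHub G (S : Set (Fin n)) (S : Set (Fin n))ᶜ} ⊆
      (⋃ u ∈ Sᶜ, {G : SimpleGraph (Fin n) | ∀ a ∈ ({u} : Finset (Fin n)), ∀ b ∈ S, ¬ G.Adj a b}) ∪
      ⋃ A ∈ F, {G : SimpleGraph (Fin n) | ∀ a ∈ A, ∀ b ∈ S \ A, ¬ G.Adj a b} := by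
    intro G hG
    by_cases hc : (G.induce (S : Set (Fin n))).Connected
    · left
      have : ¬ ∀ u ∈ (S : Set (Fin n))ᶜ, ∃ s ∈ (S : Set (Fin n)), G.Adj u s :=
        fun h => hG ⟨hc, h⟩
      push Not at this
      obtain ⟨u, hu, hus⟩ := this
      simp only [Set.mem_iUnion]
      exact ⟨u, by simpa using hu, fun _ ha b hb => by
        rw [Finset.mem_singleton.1 ha]; exact hus b hb⟩
    · right
      obtain ⟨A, hAS, hA, hA2, hsep⟩ := exists_isolated_of_not_connected G S hS hc
      simp only [Set.mem_iUnion]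
      exact ⟨A, Finset.mem_filter.2 ⟨Finset.mem_powerset.2 hAS, hA, hA2⟩, hsep⟩
  refine (MeasureTheory.measureReal_mono hsub).trans
    ((MeasureTheory.measureReal_union_le _ _).trans (add_le_add ?_ ?_))
  · refine (MeasureTheory.measureReal_biUnion_finset_le _ _).trans ?_
    calc _ ≤ ∑ _u ∈ Sᶜ, (1 - (p : ℝ)) ^ S.card := by
          refine Finset.sum_le_sum fun u hu => ?_
          simpa using binomialRandom_real_no_edges_between_le p (A := {u}) (B := S)
            (Finset.disjoint_singleton_left.2 (Finset.mem_compl.1 hu))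
      _ ≤ _ := by
          rw [Finset.sum_const, nsmul_eq_mul]
          gcongr
          simpa using Finset.card_le_univ Sᶜ
  · refine (MeasureTheory.measureReal_biUnion_finset_le _ _).trans
      (Finset.sum_le_sum fun A hA => ?_)
    have hAS := Finset.mem_powerset.1 (Finset.mem_filter.1 hA).1
    have := binomialRandom_real_no_edges_between_le p (A := A) (B := S \ A)
      Finset.disjoint_sdiff
    rwa [Finset.card_sdiff_of_subset hAS] at this

theorem one_sub_measureReal_compl_le {Ω : Type*} [MeasurableSpace Ω] (μ : MeasureTheory.Measure Ω)
    [MeasureTheory.IsProbabilityMeasure μ] (P : Ω → Prop) :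
    1 - μ.real {x | ¬ P x} ≤ μ.real {x | P x} := by
  have h := MeasureTheory.measureReal_union_le (μ := μ) {x | P x} {x | ¬ P x}
  rw [show {x | P x} ∪ {x | ¬ P x} = Set.univ by ext; simp [em], MeasureTheory.probReal_univ] at h
  linarith

/-- Bound for the expected number of cuts `(A, S \ A)` without edges. For `|A| ≤ η |S|` each node of
`A` contributes a factor at most `exp (-T)`, and the binomial theorem sums these weights; for larger
`A` the crude count `2 ^ |S|` is enough, because `|A| (|S| - |A|) ≥ η |S| ^ 2 / 2`. -/
theorem sum_cut_le {V : Type*} (S : Finset V) {p η T L : ℝ} (hp1 : p ≤ 1) (hη : 0 < η)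
    (hη1 : η < 1)
    (h1 : T ≤ (1 - η) * (p * S.card)) (h2 : S.card * Real.exp (-T) ≤ 1)
    (h3 : L + S.card * Real.log 2 ≤ η * (p * S.card) * S.card / 2) (hp0 : 0 ≤ p) :
    ∑ A ∈ S.powerset.filter (fun A => A.Nonempty ∧ 2 * A.card ≤ S.card),
        (1 - p) ^ (A.card * (S.card - A.card)) ≤
      2 * (S.card * Real.exp (-T)) + Real.exp (-L) := by
  classical
  set s := S.card
  set F := S.powerset.filter (fun A => A.Nonempty ∧ 2 * A.card ≤ s)
  have hq0 : 0 ≤ 1 - p := by linarith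
  have hexp : ∀ k : ℕ, (1 - p) ^ k ≤ Real.exp (-(p * k)) := fun k => by
    calc _ ≤ Real.exp (-p) ^ k := by
          gcongr
          linarith [Real.add_one_le_exp (-p)]
      _ = _ := by rw [← Real.exp_nat_mul]; ring_nf
  rw [← Finset.sum_filter_add_sum_filter_not F (fun A => (A.card : ℝ) ≤ η * s)]
  refine add_le_add ?_ ?_
  -- Small `A`: compare with the expansion of `(1 + exp (-T)) ^ s - 1` over nonempty subsets.
  · have hstep : ∀ A ∈ F.filter (fun A => (A.card : ℝ) ≤ η * s),
        (1 - p) ^ (A.card * (s - A.card)) ≤ Real.exp (-T) ^ A.card := by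
      intro A hA
      obtain ⟨hAF, hAs⟩ := Finset.mem_filter.1 hA
      have hle : A.card ≤ s := by have := (Finset.mem_filter.1 hAF).2.2; omega
      refine (hexp _).trans ?_
      rw [← Real.exp_nat_mul, Real.exp_le_exp]
      push_cast [Nat.cast_sub hle]
      have : T ≤ p * (s - A.card) := by nlinarith
      nlinarith [(Nat.cast_nonneg A.card : (0 : ℝ) ≤ A.card)]
    have hsub : F.filter (fun A => (A.card : ℝ) ≤ η * s) ⊆ S.powerset.erase ∅ := by
      intro A hA
      have := Finset.mem_filter.1 (Finset.mem_filter.1 hA).1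
      exact Finset.mem_erase.2 ⟨this.2.1.ne_empty, this.1⟩
    have hsum := Finset.add_sum_erase S.powerset (fun A => Real.exp (-T) ^ A.card)
      (Finset.empty_mem_powerset S)
    rw [sum_powerset_pow_card] at hsum
    simp only [Finset.card_empty, pow_zero] at hsum
    set x : ℝ := s * Real.exp (-T)
    have hx0 : 0 ≤ x := by positivity
    calc _ ≤ ∑ A ∈ F.filter (fun A => (A.card : ℝ) ≤ η * s), Real.exp (-T) ^ A.card :=
          Finset.sum_le_sum hstep
      _ ≤ ∑ A ∈ S.powerset.erase ∅, Real.exp (-T) ^ A.card :=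
          Finset.sum_le_sum_of_subset_of_nonneg hsub fun A _ _ => by positivity
      _ = (1 + Real.exp (-T)) ^ s - 1 := by linarith
      _ ≤ Real.exp (Real.exp (-T)) ^ s - 1 := by
          gcongr
          linarith [Real.add_one_le_exp (Real.exp (-T))]
      _ = Real.exp x - 1 := by rw [← Real.exp_nat_mul]
      _ ≤ 2 * x := by
          have := Real.abs_exp_sub_one_le (x := x) (by rwa [abs_of_nonneg hx0])
          rw [abs_of_nonneg hx0] at this
          exact (le_abs_self _).trans this
  -- Large `A`: every term is at most `exp (-L) / 2 ^ s`.
  · have hstep : ∀ A ∈ F.filter (fun A => ¬ (A.card : ℝ) ≤ η * s),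
        (1 - p) ^ (A.card * (s - A.card)) ≤ Real.exp (-(L + s * Real.log 2)) := by
      intro A hA
      obtain ⟨hAF, hAs⟩ := Finset.mem_filter.1 hA
      have hA2 := (Finset.mem_filter.1 hAF).2.2
      have hle : A.card ≤ s := by omega
      have hA2' : (2 : ℝ) * A.card ≤ s := by exact_mod_cast hA2
      refine (hexp _).trans (Real.exp_le_exp.2 (neg_le_neg (h3.trans ?_)))
      push_cast [Nat.cast_sub hle]
      have : η * s * (s / 2) ≤ A.card * (s - A.card : ℝ) := by
        apply mul_le_mul <;> linarith
      nlinarith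
    refine (Finset.sum_le_sum hstep).trans ?_
    rw [Finset.sum_const, nsmul_eq_mul]
    have hc : ((F.filter (fun A => ¬ (A.card : ℝ) ≤ η * s)).card : ℝ) ≤ 2 ^ s := by
      have h : (F.filter (fun A => ¬ (A.card : ℝ) ≤ η * s)).card ≤ S.powerset.card :=
        Finset.card_le_card ((Finset.filter_subset _ _).trans (Finset.filter_subset _ _))
      rw [Finset.card_powerset] at h
      exact_mod_cast h
    calc _ ≤ 2 ^ s * Real.exp (-(L + s * Real.log 2)) := by gcongr
      _ = Real.exp (-L) := by
        rw [← Real.exp_log (show (0 : ℝ) < 2 ^ s by positivity), ← Real.exp_add, Real.log_pow]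
        ring_nf

/-! ### Edge probability `β log n / n` -/

/-- For `p = β log n / n`, a set of at least `n / γ - 1` nodes with `1 < γ < β` fails to be a hub for
its complement with polynomially small probability, uniformly in the set. -/
theorem exists_not_isHub_bound {β γ : ℝ} (hγ : 1 < γ) (hγβ : γ < β) :
    ∃ α : ℝ, 0 < α ∧ ∃ C : ℝ, 0 < C ∧ ∀ᶠ n : ℕ in atTop,
      ∀ p : unitInterval, (p : ℝ) = β * Real.log n / n →
        ∀ S : Finset (Fin n), (n : ℝ) / γ - 1 ≤ S.card →
          (SimpleGraph.binomialRandom (Fin n) p).real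
            {G | ¬ IsHub G (S : Set (Fin n)) (S : Set (Fin n))ᶜ} ≤ C * (n : ℝ) ^ (-α) := by
  have hγ0 : 0 < γ := by linarith
  -- With `s ≥ n / γ - 1` nodes, `p s` is about `θ log n`. Passing from `θ` to `θ'` absorbs the `-1`,
  -- and the choice of `η` makes `(1 - η) θ' = 1 + α`.
  set θ := β / γ with hθ
  have hθ1 : 1 < θ := (one_lt_div hγ0).2 hγβ
  set θ' := (1 + θ) / 2 with hθ'
  have hθ'1 : 1 < θ' := by linarith
  have hθ'θ : θ' < θ := by linarith
  set α := (θ' - 1) / 2 with hα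
  have hα0 : 0 < α := by linarith
  set η := α / θ' with hη
  have hηθ : η * θ' = α := div_mul_cancel₀ _ (by linarith)
  have hη0 : 0 < η := by positivity
  have hη1 : η < 1 := (div_lt_one (by linarith)).2 (by linarith)
  refine ⟨α, hα0, 4, by norm_num, ?_⟩
  have hcast := tendsto_natCast_atTop_atTop (R := ℝ)
  have hlog : Tendsto (fun n : ℕ => Real.log n) atTop atTop :=
    Real.tendsto_log_atTop.comp hcast
  have e1 : ∀ᶠ n : ℕ in atTop, β / n ≤ θ - θ' :=
    ((tendsto_const_nhds (x := β)).div_atTop hcast).eventually_le_const (by linarith)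
  have e2 : ∀ᶠ n : ℕ in atTop, 2 * (1 + Real.log 2) / α ≤ Real.log n :=
    hlog.eventually_ge_atTop _
  have e3 : ∀ᶠ n : ℕ in atTop, Real.log n ≤ 1 / (2 * γ * α) * n := by
    have := (Real.isLittleO_log_id_atTop.comp_tendsto hcast).bound
      (show 0 < 1 / (2 * γ * α) by positivity)
    filter_upwards [this] with n hn
    simpa using (le_abs_self _).trans hn
  have e4 : ∀ᶠ n : ℕ in atTop, 4 * γ ≤ (n : ℝ) := hcast.eventually_ge_atTop _
  filter_upwards [e1, e2, e3, e4] with n e1 e2 e3 e4 p hp S hS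
  have hn4 : (4 : ℝ) < n := by linarith
  have hn0 : (0 : ℝ) < n := by linarith
  set l := Real.log n with hl
  have hl0 : 0 ≤ l := Real.log_nonneg (by linarith)
  have hsn : (S.card : ℝ) ≤ n := by
    exact_mod_cast (Finset.card_le_univ S).trans_eq (Fintype.card_fin n)
  set s : ℝ := (S.card : ℝ) with hs
  have hs0 : 0 < s ∧ α * l ≤ s := by
    have h1 : (4 : ℝ) ≤ n / γ := (le_div_iff₀ hγ0).2 e4
    have h2 : α * l ≤ n / γ / 2 := by
      calc α * l ≤ α * (1 / (2 * γ * α) * n) := by gcongr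
        _ = n / γ / 2 := by field_simp
    constructor <;> linarith
  -- The expected degree into `S` exceeds `log n` by the constant factor `θ'`.
  have hps : θ' * l ≤ p * s := by
    calc θ' * l ≤ (θ - β / n) * l := by gcongr; linarith
      _ = p * (n / γ - 1) := by rw [hp, hθ]; field_simp
      _ ≤ p * s := mul_le_mul_of_nonneg_left hS p.2.1
  have hpow : (n : ℝ) * Real.exp (-((1 + α) * l)) = (n : ℝ) ^ (-α) := by
    rw [Real.rpow_def_of_pos hn0]
    nth_rw 1 [← Real.exp_log hn0]
    rw [← Real.exp_add, hl]
    ring_nf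
  have hpow1 : (n : ℝ) ^ (-α) ≤ 1 :=
    Real.rpow_le_one_of_one_le_of_nonpos (by linarith) (by linarith)
  have hsT : s * Real.exp (-((1 + α) * l)) ≤ (n : ℝ) ^ (-α) := by
    rw [← hpow]; gcongr
  have hcut := sum_cut_le S (p := p) (η := η) (T := (1 + α) * l) (L := α * l) p.2.2 hη0 hη1
    (by
      calc (1 + α) * l = (1 - η) * (θ' * l) := by linear_combination l * hηθ + 2 * l * hα
        _ ≤ _ := by gcongr)
    (hsT.trans hpow1)
    (by
      have h1 : 2 * (1 + Real.log 2) ≤ l * α := (div_le_iff₀ hα0).1 e2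
      have h2 : η * (θ' * l) ≤ η * (p * s) := by gcongr
      have h3 : s * (1 + Real.log 2) ≤ s * (η * (p * s) / 2) := by
        refine mul_le_mul_of_nonneg_left ?_ hs0.1.le
        rw [← mul_assoc, hηθ] at h2
        linarith
      linarith [hs0.2])
    p.2.1
  have hq : (n : ℝ) * (1 - (p : ℝ)) ^ S.card ≤ (n : ℝ) ^ (-α) := by
    rw [← hpow]
    have : (1 - (p : ℝ)) ^ S.card ≤ Real.exp (-(p : ℝ)) ^ S.card :=
      pow_le_pow_left₀ (by linarith [p.2.2]) (by linarith [Real.add_one_le_exp (-(p : ℝ))]) _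
    rw [← Real.exp_nat_mul] at this
    refine mul_le_mul_of_nonneg_left (this.trans (Real.exp_le_exp.2 ?_)) hn0.le
    nlinarith
  have hexp : Real.exp (-(α * l)) = (n : ℝ) ^ (-α) := by
    rw [Real.rpow_def_of_pos hn0, hl]; ring_nf
  have hSne : S.Nonempty := Finset.card_pos.1 (Nat.cast_pos.1 hs0.1)
  have := binomialRandom_real_not_isHub_le p S hSne
  linarith

/-- The candidate for an `r`-partition consists of the `r` blocks of `n / r + 1` consecutive nodes
(the last ones may be shorter or empty). -/
theorem hasRPartition_of_forall_isHub {n r : ℕ} (hr : 0 < r) (G : SimpleGraph (Fin n))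
    (h : ∀ i : Fin r, IsHub G {v : Fin n | ¬ (v : ℕ) / (n / r + 1) = i}
      {v : Fin n | ¬ (v : ℕ) / (n / r + 1) = i}ᶜ) : HasRPartition G r := by
  refine ⟨fun i => {v | (v : ℕ) / (n / r + 1) = i}, fun i j hij => ?_, ?_, fun i => ?_⟩
  · refine Set.disjoint_left.2 fun v hi hj => hij (Fin.ext ?_)
    exact Eq.trans (Eq.symm hi) hj
  · refine Set.eq_univ_of_forall fun v => Set.mem_iUnion.2 ⟨⟨(v : ℕ) / (n / r + 1), ?_⟩, rfl⟩
    refine Nat.div_lt_of_lt_mul (v.2.trans ?_)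
    have := Nat.lt_mul_div_succ n hr
    rwa [mul_comm]
  · have := h i
    rwa [← Set.compl_ofPred, compl_compl] at this

theorem card_filter_div_eq_le {n q : ℕ} (hq : 0 < q) (i : ℕ) :
    (Finset.univ.filter fun v : Fin n => (v : ℕ) / q = i).card ≤ q := by
  calc _ ≤ (Finset.range q).card := by
        refine Finset.card_le_card_of_injOn (fun v => (v : ℕ) % q)
          (fun v _ => by simpa using Nat.mod_lt _ hq) fun a ha b hb hab => Fin.ext ?_
        have ha' : (a : ℕ) / q = i := by simpa using ha
        have hb' : (b : ℕ) / q = i := by simpa using hb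
        rw [← Nat.div_add_mod (a : ℕ) q, ← Nat.div_add_mod (b : ℕ) q, ha', hb']
        exact congrArg _ hab
    _ = q := Finset.card_range q

/-- The hub bound and the partition bound with common constants: the blocks of a partition into
`r ≥ γ / (γ - 1)` blocks have at most `n / r + 1` nodes, so their complements have at least
`n / γ - 1` nodes. -/
theorem exists_not_hasRPartition_bound {β γ : ℝ} (hγ : 1 < γ) (hγβ : γ < β) :
    ∃ α : ℝ, 0 < α ∧ ∃ C : ℝ, 0 < C ∧ ∀ᶠ n : ℕ in atTop,
      ∀ p : unitInterval, (p : ℝ) = β * Real.log n / n →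
        (∀ S : Finset (Fin n), (n : ℝ) / γ - 1 ≤ S.card →
          (SimpleGraph.binomialRandom (Fin n) p).real
            {G | ¬ IsHub G (S : Set (Fin n)) (S : Set (Fin n))ᶜ} ≤ C * (n : ℝ) ^ (-α)) ∧
        (SimpleGraph.binomialRandom (Fin n) p).real
            {G | ¬ HasRPartition G ⌈γ / (γ - 1)⌉₊} ≤ C * (n : ℝ) ^ (-α) := by
  obtain ⟨α, hα, C, hC, h⟩ := exists_not_isHub_bound hγ hγβ
  set r := ⌈γ / (γ - 1)⌉₊
  have hγ1 : 0 < γ - 1 := by linarith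
  have hr0 : 0 < r := Nat.ceil_pos.2 (by positivity)
  have hr1 : (1 : ℝ) ≤ r := by exact_mod_cast hr0
  refine ⟨α, hα, r * C, by positivity, ?_⟩
  filter_upwards [h] with n hn p hp
  refine ⟨fun S hS => (hn p hp S hS).trans ?_, ?_⟩
  · gcongr
    exact le_mul_of_one_le_left hC.le hr1
  set q := n / r + 1
  let S : Fin r → Finset (Fin n) := fun i => Finset.univ.filter fun v => ¬ (v : ℕ) / q = i
  have hScard : ∀ i, (n : ℝ) / γ - 1 ≤ (S i).card := by
    intro i
    have h1 : (Finset.univ.filter fun v : Fin n => (v : ℕ) / q = i).card + (S i).card = n := by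
      have := Finset.card_filter_add_card_filter_not (s := (Finset.univ : Finset (Fin n)))
        (fun v => (v : ℕ) / q = i)
      rwa [Finset.card_univ, Fintype.card_fin] at this
    have h2 := card_filter_div_eq_le (n := n) (q := q) (Nat.succ_pos _) i
    have h3 : (n : ℝ) ≤ q + (S i).card := by exact_mod_cast (by omega : n ≤ q + (S i).card)
    have h4 : (q : ℝ) ≤ n / r + 1 := by
      push_cast [q]
      gcongr
      exact Nat.cast_div_le
    have h5 : (n : ℝ) / r ≤ n - n / γ := by
      have : γ / (γ - 1) ≤ r := Nat.le_ceil _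
      rw [div_le_iff₀ (by linarith)]
      calc (n : ℝ) = (n - n / γ) * (γ / (γ - 1)) := by field_simp
        _ ≤ _ := by
          gcongr
          exact sub_nonneg.2 (div_le_self (by positivity) hγ.le)
    linarith
  have hsub : {G : SimpleGraph (Fin n) | ¬ HasRPartition G r} ⊆
      ⋃ i ∈ (Finset.univ : Finset (Fin r)),
        {G | ¬ IsHub G (S i : Set (Fin n)) (S i : Set (Fin n))ᶜ} := by
    intro G hG
    by_contra hc
    simp only [Finset.mem_univ, Set.iUnion_true, Set.mem_iUnion, Set.mem_ofPred_eq, not_exists,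
      not_not] at hc
    refine hG (hasRPartition_of_forall_isHub hr0 G fun i => ?_)
    simpa [S] using hc i
  calc _ ≤ _ := MeasureTheory.measureReal_mono hsub (MeasureTheory.measure_ne_top _ _)
    _ ≤ _ := MeasureTheory.measureReal_biUnion_finset_le _ _
    _ ≤ ∑ _i : Fin r, C * (n : ℝ) ^ (-α) := Finset.sum_le_sum fun i _ => hn p hp _ (hScard i)
    _ = _ := by simp [mul_assoc]

/-! ### Hubs, partitions and sparse recovery in `G(n, p)` -/

theorem mainTheorem8 :
    (∀ β : ℝ, 1 < β → ∀ ε : ℝ, 0 < ε → ε < β - 1 →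
      ∃ α : ℝ, 0 < α ∧ ∃ C : ℝ, 0 < C ∧ ∀ᶠ n : ℕ in atTop,
        ∀ p : unitInterval, (p : ℝ) = β * Real.log n / n →
          (∀ S : Set (Fin n),
            (S.ncard = ⌊(n : ℝ) / (β - ε)⌋₊ ∨ S.ncard = ⌈(n : ℝ) / (β - ε)⌉₊) →
            1 - C * (n : ℝ) ^ (-α) ≤
              (SimpleGraph.binomialRandom (Fin n) p).real {G | IsHub G S Sᶜ}) ∧
          1 - C * (n : ℝ) ^ (-α) ≤
            (SimpleGraph.binomialRandom (Fin n) p).real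
              {G | HasRPartition G ⌈(β - ε) / (β - ε - 1)⌉₊}) ∧
    (∃ K : ℝ, 0 < K ∧ ∀ β : ℝ, 1 < β →
      ∃ α : ℝ, 0 < α ∧ ∃ C : ℝ, 0 < C ∧ ∀ᶠ n : ℕ in atTop,
        ∀ p : unitInterval, (p : ℝ) = β * Real.log n / n →
          1 - C * (n : ℝ) ^ (-α) ≤
            (SimpleGraph.binomialRandom (Fin n) p).real
              {G | ∀ k : ℕ, 1 ≤ k → 2 * k ≤ n →
                ∃ m : ℕ, (m : ℝ) ≤ K * ⌈β / (β - 1)⌉₊ * k * Real.log ((n : ℝ) / k) ∧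
                  IdentifiableWith G k m}) := by
  refine ⟨fun β hβ ε hε hεβ => ?_, 36, by norm_num, fun β hβ => ?_⟩
  · obtain ⟨α, hα, C, hC, h⟩ :=
      exists_not_hasRPartition_bound (β := β) (γ := β - ε) (by linarith) (by linarith)
    refine ⟨α, hα, C, hC, h.mono fun n hn p hp => ⟨fun S hS => ?_, ?_⟩⟩
    · classical
      have hcard : (n : ℝ) / (β - ε) - 1 ≤ S.toFinset.card := by
        rw [← Set.ncard_eq_toFinset_card']
        rcases hS with hS | hS <;> rw [hS]
        · linarith [Nat.lt_floor_add_one ((n : ℝ) / (β - ε))]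
        · linarith [Nat.le_ceil ((n : ℝ) / (β - ε))]
      have h1 := (hn p hp).1 S.toFinset hcard
      have h2 := one_sub_measureReal_compl_le (SimpleGraph.binomialRandom (Fin n) p)
        (fun G => IsHub G S Sᶜ)
      rw [Set.coe_toFinset] at h1
      linarith
    · have h1 := (hn p hp).2
      have h2 := one_sub_measureReal_compl_le (SimpleGraph.binomialRandom (Fin n) p)
        (fun G => HasRPartition G ⌈(β - ε) / (β - ε - 1)⌉₊)
      linarith
  · have hβ1 : 0 < β - 1 := by linarith
    have hβ0 : 0 < β := by linarith
    -- With this `γ` one has `γ / (γ - 1) = β / (β - 1) + 1`, so the number of parts is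
    -- `⌈β / (β - 1)⌉ + 1 ≤ 2 ⌈β / (β - 1)⌉`; this factor 2 is absorbed by `K`.
    set γ := 1 + (β - 1) / β with hγ
    have hγ1 : 1 < γ := by
      have : 0 < (β - 1) / β := by positivity
      linarith
    have hγβ : γ < β := by
      have : (β - 1) / β < β - 1 := div_lt_self hβ1 hβ
      linarith
    have hr : ⌈γ / (γ - 1)⌉₊ = ⌈β / (β - 1)⌉₊ + 1 := by
      rw [← Nat.ceil_add_one (by positivity)]
      congr 1
      rw [hγ, add_sub_cancel_left, add_div, div_self (div_pos hβ1 hβ0).ne', one_div_div]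
    obtain ⟨α, hα, C, hC, h⟩ := exists_not_hasRPartition_bound (β := β) hγ1 hγβ
    rw [hr] at h
    refine ⟨α, hα, C, hC, h.mono fun n hn p hp => ?_⟩
    have h1 := (hn p hp).2
    have h2 := one_sub_measureReal_compl_le (SimpleGraph.binomialRandom (Fin n) p)
      (fun G => HasRPartition G (⌈β / (β - 1)⌉₊ + 1))
    refine le_trans (by linarith) (h2.trans (MeasureTheory.measureReal_mono ?_))
    intro G hG k hk hkn
    obtain ⟨m, hm, hid⟩ := identifiableWith_of_hasRPartition hG hk hkn
    refine ⟨m, hm.trans ?_, hid⟩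
    have hk0 : (0 : ℝ) < k := by exact_mod_cast hk
    have hlog : 0 ≤ Real.log ((n : ℝ) / k) := by
      refine Real.log_nonneg ((one_le_div hk0).2 ?_)
      exact_mod_cast (by omega : k ≤ n)
    have hc : (1 : ℝ) ≤ ⌈β / (β - 1)⌉₊ := by
      exact_mod_cast Nat.ceil_pos.2 (by positivity : 0 < β / (β - 1))
    have hcK : 18 * ((⌈β / (β - 1)⌉₊ + 1 : ℕ) : ℝ) ≤ 36 * ⌈β / (β - 1)⌉₊ := by
      push_cast
      linarith
    exact mul_le_mul_of_nonneg_right (mul_le_mul_of_nonneg_right hcK hk0.le) hlog
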